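/- Let $K$ be a field of characteristic $0$ (for instance $\mathbb{Q}$ or $\mathbb{C}$). For $k\ge 1$ let $H_k^{(2)}=\sum_{j=1}^{k} 1/j^2$. For $d\in\mathbb{Z}$ let ${\rm Li}_d(x)=\sum_{k\ge 1} x^k/k^d\in K[[x]]$, and let $$\beta=\sum_{k\ge 0} C_k x^{k+1}=\frac{1-\sqrt{1-4x}}{2}\in K[[x]],\qquad C_k=\frac{1}{k+1}\binom{2k}{k}.$$ Since $\beta$ has zero constant term, the composition ${\rm Li}_d(\beta)\in K[[x]]$ is well defined. Then, as formal power series in $K[[x]]$, $$\sum_{k=1}^{\infty}\binom{2k}{k}\left(\frac{H_k^{(2)}}{k}+\frac{1}{k^3}\right)x^k = 4\,{\rm Li}_3(\beta)+\frac{2}{3}\,{\rm Li}_1(\beta)^3 .$$ -/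

import Mathlib

open PowerSeries

noncomputable section

/-- The generalized harmonic number `H_k^{(d)} = ∑_{j=1}^k 1 / j^d`. -/
def genHarmonic (K : Type*) [Field K] (d k : ℕ) : K :=
  ∑ j ∈ Finset.Icc 1 k, 1 / (j : K) ^ d

/-- The polylogarithmic series `Li_d(x) = ∑_{k ≥ 1} x^k / k^d`, as a formal power series,
for any integer `d`. -/
def polylogSeries (K : Type*) [Field K] (d : ℤ) : PowerSeries K :=
  PowerSeries.mk fun k => if k = 0 then 0 else 1 / (k : K) ^ d

/-- The series `β = ∑_{k ≥ 0} C_k x^{k+1}`, where `C_k` is the `k`-th Catalan number. -/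
def catalanBeta (K : Type*) [Field K] : PowerSeries K :=
  X * PowerSeries.map (Nat.castRingHom K) catalanSeries

/-- The constant term of `β` vanishes, so every power series can be composed with `β`. -/
theorem hasSubst_catalanBeta (K : Type*) [Field K] :
    PowerSeries.HasSubst (catalanBeta K) :=
  PowerSeries.HasSubst.of_constantCoeff_zero' (by simp [catalanBeta])

/-- `(1 - 2β)² = 1 - 4x`, so that `β = (1 - √(1 - 4x)) / 2` is the root with constant term `0`. -/
theorem one_sub_two_mul_catalanBeta_sq (K : Type*) [Field K] :
    (1 - 2 * catalanBeta K) ^ 2 = 1 - 4 * X := by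
  have h := congrArg (PowerSeries.map (Nat.castRingHom K)) catalanSeries_sq_mul_X_add_one
  simp only [map_add, map_mul, map_pow, PowerSeries.map_X, map_one] at h
  unfold catalanBeta
  linear_combination 4 * X * h

end

/-! Apply `θ = x d/dx`: in characteristic 0 it determines a series up to its constant term. On the
left it turns the weights into `H_k^{(2)} + 1/k²`; on the right it lowers the index of `Li_d(β)`,
with `x = β(1 - β)` and `(1 - 2β)β' = 1` giving the chain-rule factors. The two weighted sums are
evaluated by the same method in terms of `Li₂(β)` and `Li₁(β)²`, after which only an identity of
polynomials remains. -/

/-- The generating function `∑ binom(2k, k) w(k) x^k` of the central binomial coefficients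
weighted by `w`. -/
def centralBinomSeries {K : Type*} [Field K] (w : ℕ → K) : PowerSeries K :=
  PowerSeries.mk fun k => (k.centralBinom : K) * w k

/-- The composition `Li_d(β)`. -/
noncomputable def polylogBeta (K : Type*) [Field K] (d : ℤ) : PowerSeries K :=
  PowerSeries.subst (catalanBeta K) (polylogSeries K d)

section

variable {K : Type*} [Field K]

theorem constantCoeff_catalanBeta : constantCoeff (catalanBeta K) = 0 := by
  simp [catalanBeta]

theorem catalanBeta_mul_one_sub :
    catalanBeta K * (1 - catalanBeta K) = X := by
  have h := congrArg (PowerSeries.map (Nat.castRingHom K)) catalanSeries_sq_mul_X_add_one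
  simp only [map_add, map_mul, map_pow, PowerSeries.map_X, map_one] at h
  unfold catalanBeta
  linear_combination -X * h

theorem one_sub_two_mul_catalanBeta_mul_derivative :
    (1 - 2 * catalanBeta K) * d⁄dX K (catalanBeta K) = 1 := by
  have h := congrArg (d⁄dX K) (catalanBeta_mul_one_sub (K := K))
  simp only [Derivation.leibniz, map_sub, derivative_one, derivative_X, smul_eq_mul] at h
  linear_combination h

theorem one_sub_two_mul_catalanBeta_ne_zero : 1 - 2 * catalanBeta K ≠ 0 := by
  intro h
  have := congrArg constantCoeff h
  simp [constantCoeff_catalanBeta] at this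

theorem coeff_X_mul_derivative (f : PowerSeries K) (n : ℕ) :
    coeff n (X * d⁄dX K f) = n * coeff n f := by
  cases n with
  | zero => simp
  | succ n => rw [coeff_succ_X_mul, coeff_derivative]; push_cast; ring

theorem eq_of_X_mul_derivative_eq [CharZero K] {f g : PowerSeries K}
    (h : X * d⁄dX K f = X * d⁄dX K g) (h0 : constantCoeff f = constantCoeff g) : f = g :=
  derivative.ext (mul_left_cancel₀ X_ne_zero h) h0

theorem X_mul_derivative_polylogSeries [CharZero K] (d : ℤ) :
    X * d⁄dX K (polylogSeries K (d + 1)) = polylogSeries K d := by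
  ext n
  rw [coeff_X_mul_derivative]
  simp only [polylogSeries, coeff_mk]
  split_ifs with hn
  · simp
  · have : (n : K) ≠ 0 := Nat.cast_ne_zero.mpr hn
    rw [zpow_add_one₀ this]
    field_simp

/-- This is `θ Li₁ = Li₀ = x/(1 - x)` with the factor `x` cancelled. -/
theorem one_sub_X_mul_derivative_polylogSeries_one [CharZero K] :
    (1 - X) * d⁄dX K (polylogSeries K 1) = 1 := by
  have h : d⁄dX K (polylogSeries K 1) = PowerSeries.mk 1 := by
    ext n
    have : (n : K) + 1 ≠ 0 := by exact_mod_cast n.succ_ne_zero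
    simp [coeff_derivative, polylogSeries, this]
  rw [h, mul_comm]
  exact mk_one_mul_one_sub_eq_one K

theorem constantCoeff_polylogBeta (d : ℤ) : constantCoeff (polylogBeta K d) = 0 :=
  constantCoeff_subst_eq_zero constantCoeff_catalanBeta _ (by simp [polylogSeries])

theorem catalanBeta_mul_derivative_polylogBeta [CharZero K] (d : ℤ) :
    catalanBeta K * d⁄dX K (polylogBeta K (d + 1)) =
      polylogBeta K d * d⁄dX K (catalanBeta K) := by
  have hb := hasSubst_catalanBeta K
  have h := congrArg (PowerSeries.subst (catalanBeta K))
    (X_mul_derivative_polylogSeries (K := K) d)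
  rw [subst_mul hb, subst_X hb] at h
  unfold polylogBeta
  rw [derivative_subst hb]
  linear_combination d⁄dX K (catalanBeta K) * h

theorem one_sub_catalanBeta_mul_derivative_polylogBeta_one [CharZero K] :
    (1 - catalanBeta K) * d⁄dX K (polylogBeta K 1) = d⁄dX K (catalanBeta K) := by
  have hb := hasSubst_catalanBeta K
  have h := congrArg (substAlgHom (R := K) hb)
    (one_sub_X_mul_derivative_polylogSeries_one (K := K))
  simp only [map_mul, map_sub, map_one, coe_substAlgHom, subst_X hb] at h
  unfold polylogBeta
  rw [derivative_subst hb]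
  linear_combination d⁄dX K (catalanBeta K) * h

theorem X_mul_derivative_polylogBeta_one [CharZero K] :
    X * d⁄dX K (polylogBeta K 1) = catalanBeta K * d⁄dX K (catalanBeta K) := by
  rw [← catalanBeta_mul_one_sub]
  linear_combination catalanBeta K * one_sub_catalanBeta_mul_derivative_polylogBeta_one (K := K)

theorem X_mul_derivative_polylogBeta [CharZero K] (d : ℤ) :
    X * d⁄dX K (polylogBeta K (d + 1)) =
      (1 - catalanBeta K) * polylogBeta K d * d⁄dX K (catalanBeta K) := by
  rw [← catalanBeta_mul_one_sub]
  linear_combination (1 - catalanBeta K) * catalanBeta_mul_derivative_polylogBeta (K := K) d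

theorem X_mul_derivative_centralBinomSeries (w : ℕ → K) :
    X * d⁄dX K (centralBinomSeries w) = centralBinomSeries fun k => k * w k := by
  ext n
  rw [coeff_X_mul_derivative]
  simp only [centralBinomSeries, coeff_mk]
  ring

theorem constantCoeff_centralBinomSeries (w : ℕ → K) :
    constantCoeff (centralBinomSeries w) = w 0 := by
  simp [← coeff_zero_eq_constantCoeff_apply, centralBinomSeries]

theorem derivative_catalanBeta : d⁄dX K (catalanBeta K) = centralBinomSeries 1 := by
  ext n
  have h := congrArg (Nat.cast (R := K)) (succ_mul_catalan_eq_centralBinom n)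
  push_cast at h
  rw [coeff_derivative, catalanBeta, coeff_succ_X_mul]
  simp only [centralBinomSeries, coeff_map, catalanSeries_coeff, coeff_mk, eq_natCast,
    Pi.one_apply]
  linear_combination h

theorem derivative_one_sub_two_mul_catalanBeta :
    d⁄dX K (1 - 2 * catalanBeta K) = -2 * d⁄dX K (catalanBeta K) := by
  rw [two_mul, map_sub, derivative_one, map_add]
  ring

theorem genHarmonic_succ (d k : ℕ) :
    genHarmonic K d (k + 1) = genHarmonic K d k + 1 / ((k : K) + 1) ^ d := by
  simp [genHarmonic, Finset.sum_Icc_succ_top]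

variable [CharZero K]

/-- `∑ binom(2k, k) x^k / k = 2 Li₁(β)`. -/
theorem centralBinomSeries_inv :
    centralBinomSeries (fun k => 1 / (k : K)) = 2 * polylogBeta K 1 := by
  apply eq_of_X_mul_derivative_eq
  -- The weight `k * (1 / k)` is 0 at `k = 0`, hence the `- 1`.
  · have h : centralBinomSeries (fun k => (k : K) * (1 / k)) = centralBinomSeries 1 - 1 := by
      ext n
      rcases eq_or_ne n 0 with rfl | hn
      · simp [centralBinomSeries]
      · have : (n : K) ≠ 0 := Nat.cast_ne_zero.mpr hn
        simp [centralBinomSeries, coeff_one, hn, this]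
    rw [X_mul_derivative_centralBinomSeries, h, ← derivative_catalanBeta, two_mul, map_add]
    linear_combination -2 * X_mul_derivative_polylogBeta_one (K := K) +
      one_sub_two_mul_catalanBeta_mul_derivative (K := K)
  · simp [constantCoeff_centralBinomSeries, constantCoeff_polylogBeta]

/-- `∑ binom(2k, k) x^k / k² = 2 Li₂(β) - Li₁(β)²`. -/
theorem centralBinomSeries_inv_sq :
    centralBinomSeries (fun k => 1 / (k : K) ^ 2) =
      2 * polylogBeta K 2 - polylogBeta K 1 ^ 2 := by
  apply eq_of_X_mul_derivative_eq
  · have h : (fun k : ℕ => (k : K) * (1 / (k : K) ^ 2)) = fun k : ℕ => 1 / (k : K) := by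
      ext k
      rcases eq_or_ne (k : K) 0 with hk | hk
      · simp [hk]
      · field_simp
    rw [X_mul_derivative_centralBinomSeries, h, centralBinomSeries_inv, two_mul (polylogBeta K 2),
      map_sub, map_add, pow_two, Derivation.leibniz, smul_eq_mul]
    have h2 := X_mul_derivative_polylogBeta (K := K) 1
    norm_num at h2
    linear_combination -2 * h2 + 2 * polylogBeta K 1 * X_mul_derivative_polylogBeta_one (K := K) -
      2 * polylogBeta K 1 * one_sub_two_mul_catalanBeta_mul_derivative (K := K)
  · simp [constantCoeff_centralBinomSeries, constantCoeff_polylogBeta]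

/-- The recurrence of `binom(2k, k) H_k` as a differential equation. -/
theorem X_mul_derivative_centralBinomSeries_genHarmonic :
    (1 - 4 * X) * (X * d⁄dX K (centralBinomSeries (genHarmonic K 2))) -
        2 * X * centralBinomSeries (genHarmonic K 2) =
      centralBinomSeries fun k => 1 / (k : K) := by
  have h : (1 - 4 * X) * (X * d⁄dX K (centralBinomSeries (genHarmonic K 2))) -
        2 * X * centralBinomSeries (genHarmonic K 2) =
      X * d⁄dX K (centralBinomSeries (genHarmonic K 2)) -
        X * (C (4 : K) * (X * d⁄dX K (centralBinomSeries (genHarmonic K 2))) +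
        C (2 : K) * centralBinomSeries (genHarmonic K 2)) := by
    simp only [map_ofNat]
    ring
  rw [h, X_mul_derivative_centralBinomSeries]
  ext n
  cases n with
  | zero => simp [centralBinomSeries]
  | succ n =>
    have hn : (n : K) + 1 ≠ 0 := by exact_mod_cast n.succ_ne_zero
    have hc := congrArg (Nat.cast (R := K)) (Nat.succ_mul_centralBinom_succ n)
    push_cast at hc
    rw [map_sub, coeff_succ_X_mul, map_add, coeff_C_mul, coeff_C_mul]
    simp only [centralBinomSeries, coeff_mk, genHarmonic_succ]
    push_cast
    have h1 : ((n : K) + 1) * (1 / ((n : K) + 1) ^ 2) = 1 / ((n : K) + 1) := by field_simp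
    linear_combination genHarmonic K 2 n * hc + ((n + 1).centralBinom : K) * h1

/-- `√(1 - 4x) ∑ binom(2k, k) H_k^{(2)} x^k = 2 Li₂(β) + Li₁(β)²`. -/
theorem one_sub_two_mul_catalanBeta_mul_centralBinomSeries_genHarmonic :
    (1 - 2 * catalanBeta K) * centralBinomSeries (genHarmonic K 2) =
      2 * polylogBeta K 2 + polylogBeta K 1 ^ 2 := by
  apply eq_of_X_mul_derivative_eq
  -- The extra factor produces `(1 - 2β)² = 1 - 4x`, the leading coefficient of the differential
  -- equation `hA`.
  · apply mul_left_cancel₀ (one_sub_two_mul_catalanBeta_ne_zero (K := K))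
    have hA := X_mul_derivative_centralBinomSeries_genHarmonic (K := K)
    rw [centralBinomSeries_inv, ← one_sub_two_mul_catalanBeta_sq] at hA
    have h2 := X_mul_derivative_polylogBeta (K := K) 1
    norm_num at h2
    rw [Derivation.leibniz, derivative_one_sub_two_mul_catalanBeta, two_mul (polylogBeta K 2),
      map_add, map_add, pow_two (polylogBeta K 1), Derivation.leibniz]
    simp only [smul_eq_mul]
    have hs := one_sub_two_mul_catalanBeta_mul_derivative (K := K)
    have h1 := X_mul_derivative_polylogBeta_one (K := K)
    linear_combination hA - 2 * X * centralBinomSeries (genHarmonic K 2) * hs -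
      (1 - 2 * catalanBeta K) * (2 * h2 + 2 * polylogBeta K 1 * h1) -
      2 * polylogBeta K 1 * hs
  · simp [constantCoeff_centralBinomSeries, constantCoeff_polylogBeta, genHarmonic]

end

theorem mainTheorem5 (K : Type*) [Field K] [CharZero K] :
    (PowerSeries.mk fun k : ℕ =>
        if k = 0 then 0
        else ((2 * k).choose k : K) * (genHarmonic K 2 k / (k : K) + 1 / (k : K) ^ 3)) =
      4 * PowerSeries.subst (catalanBeta K) (polylogSeries K 3) +
        PowerSeries.C (2 / 3 : K) *
          PowerSeries.subst (catalanBeta K) (polylogSeries K 1) ^ 3 := by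
  have hF : (PowerSeries.mk fun k : ℕ =>
        if k = 0 then 0
        else ((2 * k).choose k : K) * (genHarmonic K 2 k / (k : K) + 1 / (k : K) ^ 3)) =
      centralBinomSeries fun k => genHarmonic K 2 k / (k : K) + 1 / (k : K) ^ 3 := by
    ext k
    rcases eq_or_ne k 0 with rfl | hk
    · simp [centralBinomSeries]
    · simp [centralBinomSeries, hk, Nat.centralBinom_eq_two_mul_choose]
  have hF' : centralBinomSeries (fun k => (k : K) * (genHarmonic K 2 k / k + 1 / (k : K) ^ 3)) =
      centralBinomSeries (genHarmonic K 2) + centralBinomSeries fun k => 1 / (k : K) ^ 2 := by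
    ext k
    rcases eq_or_ne k 0 with rfl | hk
    · simp [centralBinomSeries, genHarmonic]
    · have : (k : K) ≠ 0 := Nat.cast_ne_zero.mpr hk
      simp only [centralBinomSeries, coeff_mk, map_add]
      field_simp
  rw [hF]
  change _ = 4 * polylogBeta K 3 + PowerSeries.C (2 / 3 : K) * polylogBeta K 1 ^ 3
  apply eq_of_X_mul_derivative_eq
  -- Multiplying by `1 - 2β` clears `β'`; both sides become `4(1 - β)Li₂(β) + 2β Li₁(β)²`.
  · apply mul_left_cancel₀ (one_sub_two_mul_catalanBeta_ne_zero (K := K))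
    have h3 := X_mul_derivative_polylogBeta (K := K) 2
    norm_num at h3
    have h1 := X_mul_derivative_polylogBeta_one (K := K)
    have hs := one_sub_two_mul_catalanBeta_mul_derivative (K := K)
    have hA := one_sub_two_mul_catalanBeta_mul_centralBinomSeries_genHarmonic (K := K)
    have hC : PowerSeries.C (2 / 3 : K) * 3 = 2 := by
      rw [← map_ofNat (PowerSeries.C (R := K)) 3, ← map_mul, div_mul_cancel₀ _ three_ne_zero,
        map_ofNat]
    have h4 : (4 : PowerSeries K) = PowerSeries.C (4 : K) := (map_ofNat _ 4).symm
    have hD : d⁄dX K (4 * polylogBeta K 3 + PowerSeries.C (2 / 3 : K) * polylogBeta K 1 ^ 3) =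
        4 * d⁄dX K (polylogBeta K 3) +
          2 * polylogBeta K 1 ^ 2 * d⁄dX K (polylogBeta K 1) := by
      rw [h4, map_add, Derivation.leibniz, Derivation.leibniz, derivative_pow, derivative_C,
        derivative_C]
      simp only [smul_eq_mul]
      push_cast
      linear_combination polylogBeta K 1 ^ 2 * d⁄dX K (polylogBeta K 1) * hC
    rw [X_mul_derivative_centralBinomSeries, hF', hD, centralBinomSeries_inv_sq]
    linear_combination hA -
      (1 - 2 * catalanBeta K) * (4 * h3 + 2 * polylogBeta K 1 ^ 2 * h1) -
      (4 * (1 - catalanBeta K) * polylogBeta K 2 +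
        2 * polylogBeta K 1 ^ 2 * catalanBeta K) * hs
  · simp [constantCoeff_centralBinomSeries, constantCoeff_polylogBeta]
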